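/- For $n\ge 1$, the stylic monoid $\mathsf{styl}_n$ of rank $n$ is the monoid given by the presentation with generators the letters of the totally ordered alphabet $\mathcal A_n=\{1<\dots<n\}$ and with defining relations $acb=cab$ for $a\le b<c$, $bac=bca$ for $a<b\le c$, and $a^2=a$, where $a,b,c\in\mathcal A_n$. A monoid $M$ satisfies an identity $u\approx v$ between words $u,v\in\Sigma^*$ over an alphabet of variables $\Sigma$ if $\psi(u)=\psi(v)$ for every monoid morphism $\psi:\Sigma^*\to M$. A word $w\in\Sigma^*$ is an isoterm for $M$ if $M$ satisfies no identity $u\approx v$ over $\Sigma$ with $u\ne v$ in which $u$ or $v$ is the word $w$. A variety is a class of monoids closed under homomorphic images, submonoids and arbitrary direct products; a subvariety of a variety is a subclass of it that is itself a variety; and the variety $\mathcal V(M)$ generated by a monoid $M$ is the smallest variety containing $M$. Let $n\ge 3$. Then, for any two distinct variables $x,y$ of any alphabet, the word $xyx$ is an isoterm for $\mathsf{styl}_n$. Moreover, the variety $\mathcal V(\mathsf{styl}_n)$ has uncountably many subvarieties. -/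

import Mathlib

universe u v

/-- The defining relations of the stylic monoid of rank `n`, on words over the totally ordered
alphabet with `n` letters: the two families of Knuth (plactic) relations, and `a² = a` for each
letter `a`. -/
inductive StylicRel (n : ℕ) : FreeMonoid (Fin n) → FreeMonoid (Fin n) → Prop
  | knuth_left (a b c : Fin n) : a ≤ b → b < c →
      StylicRel n (FreeMonoid.of a * FreeMonoid.of c * FreeMonoid.of b)
        (FreeMonoid.of c * FreeMonoid.of a * FreeMonoid.of b)
  | knuth_right (a b c : Fin n) : a < b → b ≤ c →
      StylicRel n (FreeMonoid.of b * FreeMonoid.of a * FreeMonoid.of c)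
        (FreeMonoid.of b * FreeMonoid.of c * FreeMonoid.of a)
  | idem (a : Fin n) :
      StylicRel n (FreeMonoid.of a * FreeMonoid.of a) (FreeMonoid.of a)

/-- The stylic monoid of rank `n`. -/
abbrev StylicMonoid (n : ℕ) : Type := PresentedMonoid (StylicRel n)

/-- The monoid `M` satisfies the identity `p ≈ q` over the alphabet of variables `X`: every
evaluation of the variables in `M` gives `p` and `q` the same value. -/
def SatisfiesIdentity (M : Type u) [Monoid M] {X : Type v} (p q : FreeMonoid X) : Prop :=
  ∀ ψ : FreeMonoid X →* M, ψ p = ψ q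

/-- The word `w` is an isoterm for `M`: no non-trivial identity `p ≈ q` with `p = w` or `q = w`
is satisfied by `M`. -/
def IsIsoterm (M : Type u) [Monoid M] {X : Type v} (w : FreeMonoid X) : Prop :=
  ¬ ∃ p q : FreeMonoid X, p ≠ q ∧ (p = w ∨ q = w) ∧ SatisfiesIdentity M p q

/-- A class of monoids is a variety if it is closed under homomorphic images, submonoids and
arbitrary direct products. -/
structure IsMonoidVariety (C : Set MonCat.{u}) : Prop where
  image_mem : ∀ (M N : Type u) [Monoid M] [Monoid N] (f : M →* N),
    Function.Surjective f → MonCat.of M ∈ C → MonCat.of N ∈ C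
  submonoid_mem : ∀ (M : Type u) [Monoid M] (S : Submonoid M),
    MonCat.of M ∈ C → MonCat.of S ∈ C
  pi_mem : ∀ (ι : Type u) (M : ι → Type u) [∀ i, Monoid (M i)],
    (∀ i, MonCat.of (M i) ∈ C) → MonCat.of (∀ i, M i) ∈ C

/-- The variety generated by the monoid `M`: the intersection of all varieties that contain `M`. -/
def generatedVariety (M : Type u) [Monoid M] : Set MonCat.{u} :=
  ⋂₀ {C | IsMonoidVariety C ∧ MonCat.of M ∈ C}

/-- `generatedVariety M` is the smallest variety that contains `M`. -/
theorem generatedVariety_isLeast (M : Type u) [Monoid M] :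
    IsLeast {C | IsMonoidVariety C ∧ MonCat.of M ∈ C} (generatedVariety M) := by
  refine ⟨⟨⟨?_, ?_, ?_⟩, fun C hC => hC.2⟩, fun C hC => Set.sInter_subset_of_mem hC⟩
  · intro A B _ _ f hf hA C hC
    exact hC.1.image_mem A B f hf (hA C hC)
  · intro A _ S hA C hC
    exact hC.1.submonoid_mem A S (hA C hC)
  · intro ι A _ hA C hC
    exact hC.1.pi_mem ι A fun i => hA i C hC

/-- The subvarieties of a class `V` of monoids: the subclasses of `V` that are varieties. -/
def subvarieties (V : Set MonCat.{u}) : Set (Set MonCat.{u}) :=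
  {C | IsMonoidVariety C ∧ C ⊆ V}

/-! The letters of `styl_n` act on the states `0, …, n`, the letter `k` moving `k` to `k + 1`.
Running a word from state `0` under a suitable evaluation tests whether a given word of length at
most `n` is a scattered subword, so identities of `styl_n` preserve such subwords. Subwords of
length at most three determine a word in which no letter occurs three times, so for `n ≥ 3` such
words, `xyx` among them, are isoterms.

Hence the variety contains the Rees quotient of the free monoid attached to each `crown j`. In a
crown every letter occurs twice, and alternation of letters is a cycle oriented as two paths from
`0` to `j - 2`, one of them through `j - 1` only. Swapping the first two letters removes one edge. A
substitution turning `crown i` or `crownSwap i` into `crown j` would map one oriented graph into the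
other, which forces `crown i` with `i = j` (`exists_embedding_of_flatMap_eq_crown`). So the
identities `crown i ≈ crownSwap i` are independent within the variety, and distinct sets of them cut
out distinct subvarieties. -/

/-! ### The action on states and subword detection -/

/-- The transformation of `ℕ` that moves `k` to `k + 1` and fixes everything else. -/
def advance (k : ℕ) : Function.End ℕ := fun s => if s = k then s + 1 else s

theorem advance_smul (k s : ℕ) : advance k • s = if s = k then s + 1 else s := rfl

/-- The action of the stylic monoid on `ℕ` in which the letter `k` moves `k` to `k + 1`. -/
def stylicAction (n : ℕ) : StylicMonoid n →* Function.End ℕ :=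
  PresentedMonoid.lift (fun a : Fin n => advance a) (by
    intro p q h
    -- Each Knuth relation exchanges `a` and `c`, whose maps commute unless `c = a + 1`; then `b`
    -- equals `a` or `c`, and its action makes the order irrelevant.
    induction h with
    | knuth_left a b c h₁ h₂ =>
      simp only [map_mul, FreeMonoid.lift_eval_of]
      refine eq_of_smul_eq_smul (α := ℕ) fun s => ?_
      simp only [mul_smul, advance_smul]
      rw [Fin.le_def] at h₁
      rw [Fin.lt_def] at h₂
      split_ifs <;> omega
    | knuth_right a b c h₁ h₂ =>
      simp only [map_mul, FreeMonoid.lift_eval_of]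
      refine eq_of_smul_eq_smul (α := ℕ) fun s => ?_
      simp only [mul_smul, advance_smul]
      rw [Fin.le_def] at h₂
      rw [Fin.lt_def] at h₁
      split_ifs <;> omega
    | idem a =>
      simp only [map_mul, FreeMonoid.lift_eval_of]
      refine eq_of_smul_eq_smul (α := ℕ) fun s => ?_
      simp only [mul_smul, advance_smul]
      split_ifs <;> omega)

theorem stylicAction_of {n : ℕ} (a : Fin n) :
    stylicAction n (PresentedMonoid.of (StylicRel n) a) = advance a := rfl

open Classical in
/-- The evaluation of variables in the stylic monoid that detects the subword `l`: the variable `x`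
goes to the product of the letters `k` for which `x` is the `k`-th letter of `l` from the right. -/
noncomputable def detect {X : Type v} (n : ℕ) (l : List X) : FreeMonoid X →* StylicMonoid n :=
  FreeMonoid.lift fun x => ((List.finRange n).map fun k : Fin n =>
    if l.reverse[(k : ℕ)]? = some x then PresentedMonoid.of (StylicRel n) k else 1).prod

/-- The rightmost factor acts first, so larger letters act before smaller ones, and a state that has
just moved to `k + 1` can no longer meet the letter `k + 1`: it moves at most one step. -/
theorem stylicAction_prod_smul {n : ℕ} (P : ℕ → Prop) [DecidablePred P] (ks : List (Fin n))
    (hks : ks.Pairwise (· < ·)) (s : ℕ) :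
    stylicAction n (ks.map fun k : Fin n =>
      if P k then PresentedMonoid.of (StylicRel n) k else 1).prod • s =
      if P s ∧ ∃ k ∈ ks, (k : ℕ) = s then s + 1 else s := by
  induction ks with
  | nil => simp only [List.map_nil, List.prod_nil, map_one, one_smul]; simp
  | cons k ks ih =>
    rw [List.pairwise_cons] at hks
    have hstep : ∀ t : ℕ, stylicAction n
        (if P k then PresentedMonoid.of (StylicRel n) k else 1) • t =
        if P k ∧ t = k then t + 1 else t := by
      intro t
      by_cases hk : P k
      · rw [if_pos hk, stylicAction_of, advance_smul]
        simp [hk]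
      · rw [if_neg hk, map_one, one_smul]
        simp [hk]
    rw [List.map_cons, List.prod_cons, map_mul, mul_smul, ih hks.2, hstep]
    by_cases h : P s ∧ ∃ j ∈ ks, (j : ℕ) = s
    · obtain ⟨hs, j, hj, rfl⟩ := h
      have hkj := hks.1 j hj
      rw [Fin.lt_def] at hkj
      have h₁ : P j ∧ ∃ i ∈ ks, (i : ℕ) = j := ⟨hs, j, hj, rfl⟩
      have h₂ : P j ∧ ∃ i ∈ k :: ks, (i : ℕ) = j := ⟨hs, j, List.mem_cons_of_mem _ hj, rfl⟩
      rw [if_pos h₁, if_pos h₂, if_neg (by omega)]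
    · rw [if_neg h]
      refine if_congr ⟨?_, ?_⟩ rfl rfl
      · rintro ⟨hk, rfl⟩
        exact ⟨hk, k, List.mem_cons_self, rfl⟩
      · rintro ⟨hs, j, hj, rfl⟩
        rcases List.mem_cons.1 hj with rfl | hj
        · exact ⟨hs, rfl⟩
        · exact absurd ⟨hs, j, hj, rfl⟩ h

open Classical in
theorem stylicAction_detect_of {X : Type v} {n : ℕ} {l : List X} (hl : l.length ≤ n) (x : X)
    (s : ℕ) :
    stylicAction n (detect n l (FreeMonoid.of x)) • s =
      if l.reverse[s]? = some x then s + 1 else s := by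
  rw [detect, FreeMonoid.lift_eval_of,
    stylicAction_prod_smul (fun k => l.reverse[k]? = some x) _
      (List.pairwise_lt_finRange n)]
  refine if_congr ⟨fun h => h.1, fun h => ⟨h, ?_⟩⟩ rfl rfl
  obtain ⟨hs, -⟩ := List.getElem?_eq_some_iff.1 h
  rw [List.length_reverse] at hs
  exact ⟨⟨s, by omega⟩, List.mem_finRange _, rfl⟩

/-- The state reached is the length of the longest suffix of `l` that is a subword of `w`, found by
greedy matching from the right. -/
theorem le_stylicAction_detect_iff {X : Type v} {n : ℕ} {l : List X} (hl : l.length ≤ n)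
    (w : FreeMonoid X) (k : ℕ) (hk : k ≤ l.length) :
    k ≤ stylicAction n (detect n l w) • (0 : ℕ) ↔ (l.drop (l.length - k)).Sublist w.toList := by
  classical
  induction w using FreeMonoid.inductionOn' generalizing k with
  | one =>
    simp only [map_one, one_smul, FreeMonoid.toList_one, List.sublist_nil,
      List.drop_eq_nil_iff]
    omega
  | of_mul a w ih =>
    rw [map_mul, map_mul, mul_smul, stylicAction_detect_of hl]
    simp only [FreeMonoid.toList_mul, FreeMonoid.toList_of, List.singleton_append]
    rcases k with _ | k
    · simp
    · have h₁ := ih k (by omega)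
      have h₂ := ih (k + 1) hk
      have hd : l.drop (l.length - (k + 1)) =
          l[l.length - (k + 1)]'(by omega) :: l.drop (l.length - k) := by
        rw [List.drop_eq_getElem_cons (by omega)]
        congr 2
        omega
      have hr : l.reverse[k]? = some (l[l.length - (k + 1)]'(by omega)) := by
        rw [List.getElem?_eq_some_iff]
        refine ⟨by simpa using hk, ?_⟩
        rw [List.getElem_reverse]
        congr 1
        omega
      rw [List.sublist_cons_iff, ← h₂, hd]
      simp only [List.cons.injEq]
      set s := stylicAction n (detect n l w) • (0 : ℕ) with hs
      have h₃ : (∃ r, (l[l.length - (k + 1)]'(by omega) = a ∧ l.drop (l.length - k) = r) ∧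
          r.Sublist w.toList) ↔ (l.reverse[k]? = some a ∧ k ≤ s) := by
        rw [h₁, hr, Option.some_inj]
        constructor
        · rintro ⟨r, ⟨h, rfl⟩, h'⟩
          exact ⟨h, h'⟩
        · rintro ⟨h, h'⟩
          exact ⟨_, ⟨h, rfl⟩, h'⟩
      rw [h₃]
      rcases lt_trichotomy s k with h | h | h
      · split_ifs <;> omega
      · subst h
        split_ifs with h
        · simp [h]
        · simp [h]
      · split_ifs <;> omega

/-- Both sides of an identity of the stylic monoid of rank `n` have the same subwords of length at
most `n`. -/
theorem SatisfiesIdentity.sublist_iff {X : Type v} {n : ℕ} {p q : FreeMonoid X}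
    (h : SatisfiesIdentity (StylicMonoid n) p q) {l : List X} (hl : l.length ≤ n) :
    l.Sublist p.toList ↔ l.Sublist q.toList := by
  have hp := le_stylicAction_detect_iff hl p l.length le_rfl
  have hq := le_stylicAction_detect_iff hl q l.length le_rfl
  rw [Nat.sub_self, List.drop_zero] at hp hq
  rw [← hp, ← hq, h]

/-! ### Words determined by their short subwords -/

/-- The prefix `p` is one `a` short, so the last `a` is matched beyond the displayed `b`, and all
`k` copies of `b` lie in `s`. -/
theorem List.replicate_append_replicate_sublist_of_ne {X : Type v} [DecidableEq X] {p s : List X}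
    {a b : X} (hab : a ≠ b) {k : ℕ}
    (h : (List.replicate (p.count a + 1) a ++ List.replicate k b).Sublist (p ++ b :: s)) :
    k ≤ s.count b := by
  obtain ⟨l₁, l₂, hl, h₁, h₂⟩ := List.sublist_append_iff.1 h
  rcases List.append_eq_append_iff.1 hl with ⟨c, hc, hk⟩ | ⟨c, hc, hk⟩
  · have := h₁.count_le a
    rw [hc] at this
    simp only [List.count_append, List.count_replicate_self] at this
    omega
  · rcases c with _ | ⟨d, c⟩
    · have := h₁.count_le a
      rw [List.append_nil] at hc
      rw [← hc] at this
      simp only [List.count_replicate_self] at this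
      omega
    · have hd : d = a := List.eq_of_mem_replicate
        (show d ∈ List.replicate (p.count a + 1) a by rw [hc]; simp)
      subst hd
      rw [hk] at h₂
      have h₃ : (c ++ List.replicate k b).Sublist s := by
        rcases List.sublist_cons_iff.1 h₂ with h' | ⟨r, hr, -⟩
        · exact (List.sublist_cons_self _ _).trans h'
        · simp only [List.cons_append, List.cons.injEq] at hr
          exact absurd hr.1 hab
      exact List.replicate_sublist_iff.1 ((List.sublist_append_right _ _).trans h₃)

theorem List.replicate_append_replicate_sublist {X : Type v} [DecidableEq X] (p s : List X)
    (a b : X) :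
    (List.replicate (p.count a + 1) a ++ List.replicate (s.count b) b).Sublist (p ++ a :: s) := by
  rw [List.replicate_succ', List.append_assoc]
  exact (List.replicate_sublist_iff.2 le_rfl).append
    ((List.replicate_sublist_iff.2 le_rfl).cons_cons a)

/-- Two words with the same subwords of length at most three, in one of which no letter occurs
three times, are equal. -/
theorem List.eq_of_sublist_iff {X : Type v} [DecidableEq X] {u w : List X} (p : List X)
    (hu : ∀ a, (p ++ u).count a ≤ 2)
    (h : ∀ l : List X, l.length ≤ 3 → (l.Sublist (p ++ u) ↔ l.Sublist (p ++ w))) : u = w := by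
  have hcount : ∀ a, u.count a = w.count a := by
    intro a
    have h₁ := hu a
    -- Powers of `a` up to the cube give the exact count, since it is at most two on one side.
    have key : ∀ k ≤ 3, (k ≤ (p ++ u).count a ↔ k ≤ (p ++ w).count a) := by
      intro k hk
      rw [← List.replicate_sublist_iff, ← List.replicate_sublist_iff]
      exact h _ (by simpa using hk)
    have h1 := key 1 (by omega)
    have h2 := key 2 (by omega)
    have h3 := key 3 (by omega)
    rw [List.count_append] at h₁ h1 h2 h3
    rw [List.count_append] at h1 h2 h3
    omega
  induction u generalizing w p with
  | nil =>
    rcases w with _ | ⟨b, w⟩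
    · rfl
    · simpa using hcount b
  | cons a u ih =>
    rcases w with _ | ⟨b, w⟩
    · simpa using hcount a
    · by_cases hab : a = b
      · subst hab
        congr 1
        refine ih (p ++ [a]) (by simpa using hu) (by simpa using h) fun c => ?_
        simpa [List.count_cons] using hcount c
      · exfalso
        have ha := hu a
        have hb := hu b
        have ha' := hcount a
        have hb' := hcount b
        simp only [List.count_append, List.count_cons_self] at ha ha'
        rw [List.count_append] at hb
        rw [List.count_cons_self] at hb'
        rw [List.count_cons_of_ne (Ne.symm hab)] at ha'
        rw [List.count_cons_of_ne hab] at hb hb'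
        -- At the first difference, either of two test words gives a contradiction. Their lengths
        -- sum to the counts of `a` and `b` in `p ++ a :: u` plus two, at most six, so one of them
        -- has length at most three.
        by_cases hlen : p.count a + 1 + u.count b ≤ 3
        · have := (h _ (by simpa using hlen)).1 (List.replicate_append_replicate_sublist p u a b)
          have := List.replicate_append_replicate_sublist_of_ne hab this
          omega
        · have hlen' : p.count b + 1 + w.count a ≤ 3 := by omega
          have := (h _ (by simpa using hlen')).2 (List.replicate_append_replicate_sublist p w b a)
          have := List.replicate_append_replicate_sublist_of_ne (Ne.symm hab) this
          omega

/-- A word in which no letter occurs three times is an isoterm for every stylic monoid of rank at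
least three. -/
theorem SatisfiesIdentity.eq_of_count_le_two {X : Type v} [DecidableEq X] {n : ℕ} (hn : 3 ≤ n)
    {p q : FreeMonoid X} (hp : ∀ a, p.toList.count a ≤ 2)
    (h : SatisfiesIdentity (StylicMonoid n) p q) : p = q :=
  FreeMonoid.toList.injective <| List.eq_of_sublist_iff [] (by simpa using hp) fun _ hl => by
    simpa using h.sublist_iff (hl.trans hn)

theorem isIsoterm_of_count_le_two {X : Type v} [DecidableEq X] {n : ℕ} (hn : 3 ≤ n)
    {w : FreeMonoid X} (hw : ∀ a, w.toList.count a ≤ 2) : IsIsoterm (StylicMonoid n) w := by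
  rintro ⟨p, q, hne, rfl | rfl, h⟩
  · exact hne (h.eq_of_count_le_two hn hw)
  · exact hne (SatisfiesIdentity.eq_of_count_le_two hn hw fun ψ => (h ψ).symm).symm

theorem isIsoterm_xyx {X : Type v} {n : ℕ} (hn : 3 ≤ n) {x y : X} (hxy : x ≠ y) :
    IsIsoterm (StylicMonoid n) (FreeMonoid.of x * FreeMonoid.of y * FreeMonoid.of x) := by
  classical
  refine isIsoterm_of_count_le_two hn fun a => ?_
  simp only [FreeMonoid.toList_mul, FreeMonoid.toList_of, List.cons_append, List.nil_append,
    List.count_cons, List.count_nil, beq_iff_eq]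
  split_ifs <;> simp_all

/-! ### Rees quotients, identities and varieties -/

/-- The congruence on words that collapses all words which are not factors of `w`. -/
def factorCon {X : Type v} (w : List X) : Con (FreeMonoid X) where
  r p q := p = q ∨ (¬ p.toList <:+: w ∧ ¬ q.toList <:+: w)
  iseqv := by
    refine ⟨fun p => Or.inl rfl, ?_, ?_⟩
    · rintro p q (rfl | ⟨h₁, h₂⟩)
      · exact Or.inl rfl
      · exact Or.inr ⟨h₂, h₁⟩
    · rintro p q r (rfl | ⟨h₁, h₂⟩) (rfl | ⟨h₃, h₄⟩)
      · exact Or.inl rfl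
      · exact Or.inr ⟨h₃, h₄⟩
      · exact Or.inr ⟨h₁, h₂⟩
      · exact Or.inr ⟨h₁, h₄⟩
  mul' := by
    have hl : ∀ p q : FreeMonoid X, ¬ p.toList <:+: w → ¬ (p * q).toList <:+: w := fun p q h h' =>
      h ((List.prefix_append _ _).isInfix.trans (by simpa using h'))
    have hr : ∀ p q : FreeMonoid X, ¬ q.toList <:+: w → ¬ (p * q).toList <:+: w := fun p q h h' =>
      h ((List.suffix_append _ _).isInfix.trans (by simpa using h'))
    rintro p q r s (rfl | ⟨h₁, h₂⟩) (rfl | ⟨h₃, h₄⟩)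
    · exact Or.inl rfl
    · exact Or.inr ⟨hr _ _ h₃, hr _ _ h₄⟩
    · exact Or.inr ⟨hl _ _ h₁, hl _ _ h₂⟩
    · exact Or.inr ⟨hl _ _ h₁, hl _ _ h₂⟩

theorem factorCon_iff {X : Type v} {w : List X} {p q : FreeMonoid X} :
    factorCon w p q ↔ p = q ∨ (¬ p.toList <:+: w ∧ ¬ q.toList <:+: w) := Iff.rfl

/-- The Rees quotient of the free monoid by the ideal of all words that are not factors of `w`. -/
abbrev FactorMonoid {X : Type v} (w : List X) : Type v := (factorCon w).Quotient

/-- An identity holds in the Rees quotient of `w` if it is trivial under every substitution that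
makes one of its sides a factor of `w`. -/
theorem satisfiesIdentity_factorMonoid {X Y : Type*} {w : List X} {p q : FreeMonoid Y}
    (h : ∀ θ : FreeMonoid Y →* FreeMonoid X,
      (θ p).toList <:+: w ∨ (θ q).toList <:+: w → θ p = θ q) :
    SatisfiesIdentity (FactorMonoid w) p q := by
  intro ψ
  choose f hf using fun y => Con.mk'_surjective (c := factorCon w) (ψ (FreeMonoid.of y))
  have hψ : ψ = (factorCon w).mk'.comp (FreeMonoid.lift f) :=
    FreeMonoid.hom_eq fun y => by rw [MonoidHom.comp_apply, FreeMonoid.lift_eval_of, hf]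
  rw [hψ]
  refine (Con.eq (factorCon w)).2 (factorCon_iff.2 ?_)
  by_cases hw : (FreeMonoid.lift f p).toList <:+: w ∨ (FreeMonoid.lift f q).toList <:+: w
  · exact Or.inl (h _ hw)
  · exact Or.inr (not_or.1 hw)

theorem not_satisfiesIdentity_factorMonoid {X : Type v} {w p q : FreeMonoid X}
    (hp : p.toList <:+: w.toList) (hpq : p ≠ q) :
    ¬ SatisfiesIdentity (FactorMonoid w.toList) p q := by
  intro h
  rcases factorCon_iff.1 ((Con.eq (factorCon w.toList)).1 (h (factorCon w.toList).mk')) with h | h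
  · exact hpq h
  · exact h.1 hp

theorem SatisfiesIdentity.of_surjective {M N : Type*} [Monoid M] [Monoid N] {X : Type*}
    {p q : FreeMonoid X} (h : SatisfiesIdentity M p q) {f : M →* N}
    (hf : Function.Surjective f) : SatisfiesIdentity N p q := by
  intro ψ
  choose g hg using fun x => hf (ψ (FreeMonoid.of x))
  have hψ : ψ = f.comp (FreeMonoid.lift g) := FreeMonoid.hom_eq fun x => by simp [hg]
  rw [hψ, MonoidHom.comp_apply, MonoidHom.comp_apply, h]

theorem SatisfiesIdentity.of_injective {M N : Type*} [Monoid M] [Monoid N] {X : Type*}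
    {p q : FreeMonoid X} (h : SatisfiesIdentity N p q) {f : M →* N}
    (hf : Function.Injective f) : SatisfiesIdentity M p q :=
  fun ψ => hf (h (f.comp ψ))

theorem SatisfiesIdentity.pi {ι : Type*} {M : ι → Type*} [∀ i, Monoid (M i)] {X : Type*}
    {p q : FreeMonoid X} (h : ∀ i, SatisfiesIdentity (M i) p q) :
    SatisfiesIdentity (∀ i, M i) p q :=
  fun ψ => funext fun i => h i ((Pi.evalMonoidHom M i).comp ψ)

/-- The members of a variety that satisfy a given family of identities form a variety. -/
theorem IsMonoidVariety.inter_identities {C : Set MonCat.{u}} (hC : IsMonoidVariety C)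
    {ι X : Type*} (p q : ι → FreeMonoid X) (A : Set ι) :
    IsMonoidVariety {M | M ∈ C ∧ ∀ i ∈ A, SatisfiesIdentity M (p i) (q i)} where
  image_mem M N _ _ f hf hM :=
    ⟨hC.image_mem M N f hf hM.1, fun i hi =>
      SatisfiesIdentity.of_surjective (M := M) (hM.2 i hi) hf⟩
  submonoid_mem M _ S hM :=
    ⟨hC.submonoid_mem M S hM.1, fun i hi =>
      SatisfiesIdentity.of_injective (N := M) (hM.2 i hi) (f := S.subtype)
        Subtype.val_injective⟩
  pi_mem κ M _ hM :=
    ⟨hC.pi_mem κ M fun k => (hM k).1, fun i hi =>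
      SatisfiesIdentity.pi (M := M) fun k => (hM k).2 i hi⟩

/-- If every factor of `w` is an isoterm for `M`, then the Rees quotient of `w` belongs to the
variety generated by `M`. -/
theorem factorMonoid_mem_generatedVariety {M : Type u} [Monoid M] {X : Type} {w : List X}
    (h : ∀ p q : FreeMonoid X, p.toList <:+: w → SatisfiesIdentity M p q → p = q) :
    MonCat.of (ULift.{u} (FactorMonoid w)) ∈ generatedVariety M := by
  obtain ⟨hV, hM⟩ := (generatedVariety_isLeast M).1
  -- The range of `F` is the relatively free monoid on `X`, inside a power of `M`; by `hF` the Rees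
  -- quotient is an image of it.
  let F : FreeMonoid X →* ((FreeMonoid X →* M) → M) := MonoidHom.pi fun ψ => ψ
  have hF : ∀ p q, F p = F q → factorCon w p q := by
    intro p q hpq
    have hs : SatisfiesIdentity M p q := fun ψ => congrFun hpq ψ
    by_cases hp : p.toList <:+: w
    · exact Or.inl (h p q hp hs)
    · by_cases hq : q.toList <:+: w
      · exact Or.inl (h q p hq fun ψ => (hs ψ).symm).symm
      · exact Or.inr ⟨hp, hq⟩
  have hR : MonCat.of (MonoidHom.mrange F) ∈ generatedVariety M :=
    hV.submonoid_mem _ _ (hV.pi_mem _ (fun _ => M) fun _ => hM)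
  choose g hg using fun y : MonoidHom.mrange F => y.2
  let G : MonoidHom.mrange F →* ULift.{u} (FactorMonoid w) :=
    { toFun := fun y => ULift.up ((factorCon w).mk' (g y))
      map_one' := ULift.ext _ _ ((Con.eq _).2 (hF _ _ (by rw [hg, map_one]; rfl)))
      map_mul' := fun y z => ULift.ext _ _
        ((Con.eq _).2 (hF _ _ (by rw [map_mul, hg, hg, hg]; rfl))) }
  refine hV.image_mem _ _ G ?_ hR
  rintro ⟨y⟩
  obtain ⟨p, rfl⟩ := Con.mk'_surjective y
  exact ⟨⟨F p, p, rfl⟩, ULift.ext _ _ ((Con.eq _).2 (hF _ _ (hg _)))⟩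

theorem satisfiesIdentity_ulift_iff {M : Type v} [Monoid M] {X : Type*} {p q : FreeMonoid X} :
    SatisfiesIdentity (ULift.{u} M) p q ↔ SatisfiesIdentity M p q :=
  ⟨fun h => h.of_surjective (f := (MulEquiv.ulift : ULift.{u} M ≃* M).toMonoidHom)
      (MulEquiv.ulift : ULift.{u} M ≃* M).surjective,
    fun h => h.of_injective (f := (MulEquiv.ulift : ULift.{u} M ≃* M).toMonoidHom)
      (MulEquiv.ulift : ULift.{u} M ≃* M).injective⟩

/-- A variety has uncountably many subvarieties if, for some infinite sequence of identities, it
contains for every `j` a monoid satisfying all identities of the sequence but the `j`-th. -/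
theorem not_countable_subvarieties {V : Set MonCat.{u}} (hV : IsMonoidVariety V) {X : Type*}
    (p q : ℕ → FreeMonoid X)
    (h : ∀ j, ∃ M ∈ V, ∀ i, SatisfiesIdentity M (p i) (q i) ↔ i ≠ j) :
    ¬ (subvarieties V).Countable := by
  intro hc
  let F : Set ℕ → Set MonCat.{u} := fun A =>
    {M | M ∈ V ∧ ∀ i ∈ A, SatisfiesIdentity M (p i) (q i)}
  have hF : Function.Injective F := by
    have key : ∀ A B : Set ℕ, F A = F B → A ⊆ B := by
      intro A B hAB j hjA
      by_contra hjB
      obtain ⟨M, hM, hi⟩ := h j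
      -- The `j`-th monoid violates only the `j`-th identity, so it lies in `F B` but not in `F A`.
      have hMB : M ∈ F B := ⟨hM, fun i hiB => (hi i).2 fun hij => hjB (hij ▸ hiB)⟩
      rw [← hAB] at hMB
      exact (hi j).1 (hMB.2 j hjA) rfl
    exact fun A B hAB => (key A B hAB).antisymm (key B A hAB.symm)
  have hsub : Set.range F ⊆ subvarieties V := by
    rintro _ ⟨A, rfl⟩
    exact ⟨hV.inter_identities p q A, fun M hM => hM.1⟩
  have : Countable (Set ℕ) := by
    have := (hc.mono hsub).to_subtype
    exact (Set.rangeFactorization_injective.2 hF).countable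
  obtain ⟨f, hf⟩ := exists_injective_nat (Set ℕ)
  exact Function.cantor_injective f hf

/-! ### Subwords as increasing sequences of positions -/

theorem List.sublist_map_range_iff {X : Type v} {g : ℕ → X} {n : ℕ} {l : List X} :
    l.Sublist ((List.range n).map g) ↔
      ∃ ps : List ℕ, ps.Pairwise (· < ·) ∧ (∀ p ∈ ps, p < n) ∧ ps.map g = l := by
  rw [List.sublist_map_iff]
  constructor
  · rintro ⟨ps, hps, rfl⟩
    exact ⟨ps, List.pairwise_lt_range.sublist hps, fun p hp => List.mem_range.1 (hps.subset hp), rfl⟩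
  · rintro ⟨ps, hps, hn, rfl⟩
    refine ⟨ps, List.sublist_of_subperm_of_sortedLE ?_ ?_ ?_, rfl⟩
    · exact List.subperm_of_subset (hps.imp ne_of_lt) fun p hp => List.mem_range.2 (hn p hp)
    · exact hps.sortedLT.sortedLE
    · exact (List.sortedLT_range n).sortedLE

theorem List.pair_sublist_map_range_iff {X : Type v} {g : ℕ → X} {n : ℕ} {a b : X} :
    [a, b].Sublist ((List.range n).map g) ↔ ∃ p q, p < q ∧ q < n ∧ g p = a ∧ g q = b := by
  rw [List.sublist_map_range_iff]
  constructor
  · rintro ⟨ps, hlt, hn, h⟩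
    obtain ⟨p, tp, rfl, rfl, hp⟩ := List.map_eq_cons_iff.1 h
    obtain ⟨q, tq, rfl, rfl, hq⟩ := List.map_eq_cons_iff.1 hp
    obtain rfl := List.map_eq_nil_iff.1 hq
    simp only [List.pairwise_cons, List.mem_cons, List.not_mem_nil, or_false, forall_eq] at hlt hn
    exact ⟨p, q, hlt.1, hn q (Or.inr rfl), rfl, rfl⟩
  · rintro ⟨p, q, h₁, h₂, rfl, rfl⟩
    refine ⟨[p, q], by simp [h₁], ?_, rfl⟩
    simp only [List.mem_cons, List.not_mem_nil, or_false, forall_eq_or_imp, forall_eq]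
    omega

theorem List.triple_sublist_map_range_iff {X : Type v} {g : ℕ → X} {n : ℕ} {a b c : X} :
    [a, b, c].Sublist ((List.range n).map g) ↔
      ∃ p q r, p < q ∧ q < r ∧ r < n ∧ g p = a ∧ g q = b ∧ g r = c := by
  rw [List.sublist_map_range_iff]
  constructor
  · rintro ⟨ps, hlt, hn, h⟩
    obtain ⟨p, tp, rfl, rfl, hp⟩ := List.map_eq_cons_iff.1 h
    obtain ⟨q, tq, rfl, rfl, hq⟩ := List.map_eq_cons_iff.1 hp
    obtain ⟨r, tr, rfl, rfl, hr⟩ := List.map_eq_cons_iff.1 hq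
    obtain rfl := List.map_eq_nil_iff.1 hr
    simp only [List.pairwise_cons, List.mem_cons, List.not_mem_nil, or_false] at hlt hn
    exact ⟨p, q, r, hlt.1 q (by simp), hlt.2.1 r (by simp), hn r (by simp), rfl, rfl, rfl⟩
  · rintro ⟨p, q, r, h₁, h₂, h₃, rfl, rfl, rfl⟩
    refine ⟨[p, q, r], ?_, ?_, rfl⟩ <;>
      simp only [List.pairwise_cons, List.mem_cons, List.not_mem_nil, or_false,
        forall_eq_or_imp, forall_eq] <;> (try simp) <;> omega

theorem List.quadruple_sublist_map_range_iff {X : Type v} {g : ℕ → X} {n : ℕ} {a b c d : X} :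
    [a, b, c, d].Sublist ((List.range n).map g) ↔
      ∃ p q r s, p < q ∧ q < r ∧ r < s ∧ s < n ∧ g p = a ∧ g q = b ∧ g r = c ∧ g s = d := by
  rw [List.sublist_map_range_iff]
  constructor
  · rintro ⟨ps, hlt, hn, h⟩
    obtain ⟨p, tp, rfl, rfl, hp⟩ := List.map_eq_cons_iff.1 h
    obtain ⟨q, tq, rfl, rfl, hq⟩ := List.map_eq_cons_iff.1 hp
    obtain ⟨r, tr, rfl, rfl, hr⟩ := List.map_eq_cons_iff.1 hq
    obtain ⟨s, ts, rfl, rfl, hs⟩ := List.map_eq_cons_iff.1 hr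
    obtain rfl := List.map_eq_nil_iff.1 hs
    simp only [List.pairwise_cons, List.mem_cons, List.not_mem_nil, or_false] at hlt hn
    exact ⟨p, q, r, s, hlt.1 q (by simp), hlt.2.1 r (by simp), hlt.2.2.1 s (by simp),
      hn s (by simp), rfl, rfl, rfl, rfl⟩
  · rintro ⟨p, q, r, s, h₁, h₂, h₃, h₄, rfl, rfl, rfl, rfl⟩
    refine ⟨[p, q, r, s], ?_, ?_, rfl⟩ <;>
      simp only [List.pairwise_cons, List.mem_cons, List.not_mem_nil, or_false,
        forall_eq_or_imp, forall_eq] <;> (try simp) <;> omega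

/-- The two letters `a` and `b` alternate in the word `w`, the letter `a` coming first. -/
def Crosses {X : Type v} (w : List X) (a b : X) : Prop := [a, b, a, b].Sublist w

/-- The two occurrences of two letters in a word come in one of six orders. -/
theorem sublist_cases {X : Type v} {u : List X} {x y : X} (hxy : x ≠ y)
    (hx : [x, x].Sublist u) (hy : [y, y].Sublist u) :
    Crosses u x y ∨ Crosses u y x ∨ [x, x, y, y].Sublist u ∨ [y, y, x, x].Sublist u ∨
      [x, y, y, x].Sublist u ∨ [y, x, x, y].Sublist u := by
  have hu : u = (List.range u.length).map fun p => u.getD p x :=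
    List.ext_getElem (by simp) fun i h₁ h₂ => by simp [h₁]
  unfold Crosses
  generalize u.length = n at hu
  generalize (fun p => u.getD p x) = g at hu
  subst hu
  obtain ⟨p, q, hpq, hq, hp₁, hq₁⟩ := List.pair_sublist_map_range_iff.1 hx
  obtain ⟨r, s, hrs, hs, hr₁, hs₁⟩ := List.pair_sublist_map_range_iff.1 hy
  simp only [List.quadruple_sublist_map_range_iff]
  have h₁ : p ≠ r := by rintro rfl; exact hxy (hp₁.symm.trans hr₁)
  have h₂ : p ≠ s := by rintro rfl; exact hxy (hp₁.symm.trans hs₁)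
  have h₃ : q ≠ r := by rintro rfl; exact hxy (hq₁.symm.trans hr₁)
  have h₄ : q ≠ s := by rintro rfl; exact hxy (hq₁.symm.trans hs₁)
  rcases lt_or_gt_of_ne h₁ with h₁ | h₁ <;> rcases lt_or_gt_of_ne h₂ with h₂ | h₂ <;>
    rcases lt_or_gt_of_ne h₃ with h₃ | h₃ <;> rcases lt_or_gt_of_ne h₄ with h₄ | h₄ <;>
    first
    | exact Or.inl ⟨p, r, q, s, by omega, by omega, by omega, by omega, hp₁, hr₁, hq₁, hs₁⟩
    | exact Or.inr (Or.inl
        ⟨r, p, s, q, by omega, by omega, by omega, by omega, hr₁, hp₁, hs₁, hq₁⟩)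
    | exact Or.inr (Or.inr (Or.inl
        ⟨p, q, r, s, by omega, by omega, by omega, by omega, hp₁, hq₁, hr₁, hs₁⟩))
    | exact Or.inr (Or.inr (Or.inr (Or.inl
        ⟨r, s, p, q, by omega, by omega, by omega, by omega, hr₁, hs₁, hp₁, hq₁⟩)))
    | exact Or.inr (Or.inr (Or.inr (Or.inr (Or.inl
        ⟨p, r, s, q, by omega, by omega, by omega, by omega, hp₁, hr₁, hs₁, hq₁⟩))))
    | exact Or.inr (Or.inr (Or.inr (Or.inr (Or.inr
        ⟨r, p, q, s, by omega, by omega, by omega, by omega, hr₁, hp₁, hq₁, hs₁⟩))))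

/-! ### Crowns and their alternating letters -/

/-- The letter at position `p` of the word `crown k`. -/
def crownLetter (k p : ℕ) : ℕ :=
  if p % 2 = 0 then p / 2 else if p = 1 then k - 1 else p / 2 - 1

/-- The word `0 (k-1) 1 0 2 1 3 2 … (k-1) (k-2)`, in which each of the letters `0, …, k - 1` occurs
twice and the pairs of alternating letters form a cycle. -/
def crown (k : ℕ) : List ℕ := (List.range (2 * k)).map (crownLetter k)

/-- The word `crown k` with its first two letters swapped. -/
def crownSwap (k : ℕ) : List ℕ :=
  (List.range (2 * k)).map fun p => crownLetter k (if p = 0 then 1 else if p = 1 then 0 else p)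

theorem crownLetter_lt {k p : ℕ} (hp : p < 2 * k) : crownLetter k p < k := by
  unfold crownLetter
  split_ifs <;> omega

theorem crownLetter_eq_iff {k p a : ℕ} (hp : p < 2 * k) :
    crownLetter k p = a ↔ (p = 2 * a ∨ (p = 2 * a + 3 ∧ a < k - 1) ∨ (p = 1 ∧ a = k - 1)) := by
  unfold crownLetter
  split_ifs <;> omega

theorem mem_crown {k a : ℕ} : a ∈ crown k ↔ a < k := by
  simp only [crown, List.mem_map, List.mem_range]
  constructor
  · rintro ⟨p, hp, rfl⟩
    exact crownLetter_lt hp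
  · intro ha
    exact ⟨2 * a, by omega, by unfold crownLetter; split_ifs <;> omega⟩

theorem mem_crownSwap {k a : ℕ} : a ∈ crownSwap k ↔ a < k := by
  simp only [crownSwap, List.mem_map, List.mem_range]
  constructor
  · rintro ⟨p, hp, rfl⟩
    exact crownLetter_lt (by split_ifs <;> omega)
  · intro ha
    exact ⟨if a = 0 then 1 else 2 * a, by split_ifs <;> omega,
      by unfold crownLetter; split_ifs <;> omega⟩

theorem pair_sublist_crown {k a : ℕ} (hk : 2 ≤ k) (ha : a < k) : [a, a].Sublist (crown k) := by
  rw [crown, List.pair_sublist_map_range_iff]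
  rcases Nat.lt_or_ge a (k - 1) with h | h
  · refine ⟨2 * a, 2 * a + 3, ?_⟩
    iterate 2 rw [crownLetter_eq_iff (by omega)]
    omega
  · refine ⟨1, 2 * a, ?_⟩
    iterate 2 rw [crownLetter_eq_iff (by omega)]
    omega

theorem pair_sublist_crownSwap {k a : ℕ} (hk : 2 ≤ k) (ha : a < k) :
    [a, a].Sublist (crownSwap k) := by
  rw [crownSwap, List.pair_sublist_map_range_iff]
  obtain h | ⟨h, h'⟩ | h : a = 0 ∨ (0 < a ∧ a < k - 1) ∨ a = k - 1 := by omega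
  · refine ⟨1, 3, by omega, by omega, ?_⟩
    rw [if_neg (by omega), if_pos rfl, if_neg (by omega), if_neg (by omega),
      crownLetter_eq_iff (by omega), crownLetter_eq_iff (by omega)]
    omega
  · refine ⟨2 * a, 2 * a + 3, by omega, by omega, ?_⟩
    rw [if_neg (by omega), if_neg (by omega), if_neg (by omega), if_neg (by omega),
      crownLetter_eq_iff (by omega), crownLetter_eq_iff (by omega)]
    omega
  · refine ⟨0, 2 * a, by omega, by omega, ?_⟩
    rw [if_pos rfl, if_neg (by omega), if_neg (by omega),
      crownLetter_eq_iff (by omega), crownLetter_eq_iff (by omega)]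
    omega

theorem crownLetter_eq_cases {k p q r : ℕ} (hpq : p < q) (hq : q < 2 * k)
    (hr : r < 2 * k) (h : crownLetter k p = crownLetter k q)
    (h' : crownLetter k p = crownLetter k r) : r = p ∨ r = q := by
  unfold crownLetter at h h'
  split_ifs at h h' <;> omega

theorem not_triple_sublist_crown (k a : ℕ) : ¬ [a, a, a].Sublist (crown k) := by
  rw [crown, List.triple_sublist_map_range_iff]
  rintro ⟨p, q, r, hpq, hqr, hr, hp₁, hq₁, hr₁⟩
  have := crownLetter_eq_cases hpq (by omega) hr (hp₁.trans hq₁.symm) (hp₁.trans hr₁.symm)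
  omega

theorem count_crown_le (k a : ℕ) : (crown k).count a ≤ 2 := by
  by_contra h
  exact not_triple_sublist_crown k a
    (List.replicate_sublist_iff (n := 3).2 (by omega))

theorem crown_ne_crownSwap {k : ℕ} (hk : 2 ≤ k) : crown k ≠ crownSwap k := by
  intro h
  have := congrArg (fun l => l[0]?) h
  simp only [crown, crownSwap, List.getElem?_map, List.getElem?_range (show 0 < 2 * k by omega),
    Option.map_some, Option.some_inj, crownLetter] at this
  simp at this
  omega

/-- Two letters of a crown that alternate do not occur in any other order. -/
theorem Crosses.not_sublist {k a b : ℕ} (hab : a ≠ b) (h : Crosses (crown k) a b) :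
    ¬ Crosses (crown k) b a ∧ ¬ [a, a, b, b].Sublist (crown k) ∧
      ¬ [b, b, a, a].Sublist (crown k) ∧ ¬ [a, b, b, a].Sublist (crown k) ∧
      ¬ [b, a, a, b].Sublist (crown k) := by
  rw [Crosses, crown, List.quadruple_sublist_map_range_iff] at h
  obtain ⟨p, q, r, s, hpq, hqr, hrs, hs, rfl, rfl, hr₁, hs₁⟩ := h
  have hp : ∀ t < 2 * k, crownLetter k t = crownLetter k p → t = p ∨ t = r := fun t ht h =>
    crownLetter_eq_cases (by omega) (by omega) ht hr₁.symm h.symm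
  have hq : ∀ t < 2 * k, crownLetter k t = crownLetter k q → t = q ∨ t = s := fun t ht h =>
    crownLetter_eq_cases (by omega) (by omega) ht hs₁.symm h.symm
  simp only [Crosses, crown, List.quadruple_sublist_map_range_iff]
  refine ⟨?_, ?_, ?_, ?_, ?_⟩
  · rintro ⟨p', q', r', s', h₁, h₂, h₃, h₄, hp', hq', hr', hs'⟩
    have := hq p' (by omega) hp'
    have := hp q' (by omega) hq'
    have := hq r' (by omega) hr'
    have := hp s' (by omega) hs'
    omega
  · rintro ⟨p', q', r', s', h₁, h₂, h₃, h₄, hp', hq', hr', hs'⟩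
    have := hp p' (by omega) hp'
    have := hp q' (by omega) hq'
    have := hq r' (by omega) hr'
    have := hq s' (by omega) hs'
    omega
  · rintro ⟨p', q', r', s', h₁, h₂, h₃, h₄, hp', hq', hr', hs'⟩
    have := hq p' (by omega) hp'
    have := hq q' (by omega) hq'
    have := hp r' (by omega) hr'
    have := hp s' (by omega) hs'
    omega
  · rintro ⟨p', q', r', s', h₁, h₂, h₃, h₄, hp', hq', hr', hs'⟩
    have := hp p' (by omega) hp'
    have := hq q' (by omega) hq'
    have := hq r' (by omega) hr'
    have := hp s' (by omega) hs'
    omega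
  · rintro ⟨p', q', r', s', h₁, h₂, h₃, h₄, hp', hq', hr', hs'⟩
    have := hq p' (by omega) hp'
    have := hp q' (by omega) hq'
    have := hp r' (by omega) hr'
    have := hq s' (by omega) hs'
    omega

/-- The cycle of alternations is oriented as `0 → 1 → ⋯ → k - 2` together with `0 → k - 1 → k - 2`.
-/
theorem crosses_crown_iff {k a b : ℕ} (hk : 5 ≤ k) : Crosses (crown k) a b ↔
    (b = a + 1 ∧ b < k - 1) ∨ (a = 0 ∧ b = k - 1) ∨ (a = k - 1 ∧ b = k - 2) := by
  rw [Crosses, crown, List.quadruple_sublist_map_range_iff]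
  constructor
  · rintro ⟨p, q, r, s, hpq, hqr, hrs, hs, hp₁, hq₁, hr₁, hs₁⟩
    rw [crownLetter_eq_iff (by omega)] at hp₁ hq₁ hr₁ hs₁
    omega
  · rintro (⟨rfl, h⟩ | ⟨rfl, rfl⟩ | ⟨rfl, rfl⟩)
    · refine ⟨2 * a, 2 * a + 2, 2 * a + 3, 2 * a + 5, ?_⟩
      iterate 4 rw [crownLetter_eq_iff (by omega)]
      omega
    · refine ⟨0, 1, 3, 2 * k - 2, ?_⟩
      iterate 4 rw [crownLetter_eq_iff (by omega)]
      omega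
    · refine ⟨1, 2 * k - 4, 2 * k - 2, 2 * k - 1, ?_⟩
      iterate 4 rw [crownLetter_eq_iff (by omega)]
      omega

/-- The swap nests the two occurrences of `0` between those of `k - 1`. The edge `0 → k - 1` is
lost, and no letter keeps two outgoing edges. -/
theorem Crosses.of_crownSwap {k a b : ℕ} (hk : 5 ≤ k) (h : Crosses (crownSwap k) a b) :
    (b = a + 1 ∧ b < k - 1) ∨ (a = k - 1 ∧ b = k - 2) := by
  rw [Crosses, crownSwap, List.quadruple_sublist_map_range_iff] at h
  obtain ⟨p, q, r, s, hpq, hqr, hrs, hs, hp₁, hq₁, hr₁, hs₁⟩ := h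
  have hr₀ : ¬ r = 0 := by omega
  have hr₁' : ¬ r = 1 := by omega
  have hs₀ : ¬ s = 0 := by omega
  have hs₁' : ¬ s = 1 := by omega
  simp only [hr₀, hr₁', hs₀, hs₁', if_false] at hr₁ hs₁
  generalize hP : (if p = 0 then 1 else if p = 1 then 0 else p) = P at hp₁
  generalize hQ : (if q = 0 then 1 else if q = 1 then 0 else q) = Q at hq₁
  have hP' : (p = 0 ∧ P = 1) ∨ (p = 1 ∧ P = 0) ∨ (2 ≤ p ∧ P = p) := by
    split_ifs at hP <;> omega
  have hQ' : (q = 0 ∧ Q = 1) ∨ (q = 1 ∧ Q = 0) ∨ (2 ≤ q ∧ Q = q) := by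
    split_ifs at hQ <;> omega
  rw [crownLetter_eq_iff (by omega)] at hp₁ hq₁ hr₁ hs₁
  omega

/-! ### Substitutions whose value is a crown -/

theorem List.pair_sublist_flatMap {X Y : Type*} {θ : X → List Y} {u : List X} {x y : X}
    {a b : Y} (h : [x, y].Sublist u) (ha : a ∈ θ x) (hb : b ∈ θ y) :
    [a, b].Sublist (u.flatMap θ) := by
  refine List.Sublist.trans ?_ (h.flatMap θ)
  simpa using (List.singleton_sublist.2 ha).append (List.singleton_sublist.2 hb)

theorem List.quadruple_sublist_flatMap {X Y : Type*} {θ : X → List Y} {u : List X}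
    {x y z t : X} {a b c d : Y} (h : [x, y, z, t].Sublist u) (ha : a ∈ θ x) (hb : b ∈ θ y)
    (hc : c ∈ θ z) (hd : d ∈ θ t) : [a, b, c, d].Sublist (u.flatMap θ) := by
  refine List.Sublist.trans ?_ (h.flatMap θ)
  simpa using (List.singleton_sublist.2 ha).append ((List.singleton_sublist.2 hb).append
    ((List.singleton_sublist.2 hc).append (List.singleton_sublist.2 hd)))

/-- A nonempty factor of a crown in which every letter occurs at least twice is the whole crown. -/
theorem eq_crown_of_isInfix {k : ℕ} (hk : 5 ≤ k) {f : List ℕ} (hf : f <:+: crown k)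
    (hne : f ≠ []) (h2 : ∀ a ∈ f, [a, a].Sublist f) : f = crown k := by
  obtain ⟨s, t, hst⟩ := hf
  have hs : ∀ a ∈ f, a ∉ s := by
    intro a ha has
    apply not_triple_sublist_crown k a
    rw [← hst]
    simpa using ((List.singleton_sublist.2 has).append (h2 a ha)).append (List.nil_sublist t)
  have ht : ∀ a ∈ f, a ∉ t := by
    intro a ha hat
    apply not_triple_sublist_crown k a
    rw [← hst]
    simpa using ((List.nil_sublist s).append (h2 a ha)).append (List.singleton_sublist.2 hat)
  -- Both occurrences of `a` lie in `f`, hence so does everything between them; connectedness of the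
  -- cycle then spreads membership to all letters.
  have hmem : ∀ a b, [a, b, a].Sublist (crown k) → a ∈ f → b ∈ f := by
    intro a b h ha
    rw [← hst] at h
    obtain ⟨l', l₃, hl, h', h₃⟩ := List.sublist_append_iff.1 h
    obtain ⟨l₁, l₂, hl', h₁, h₂⟩ := List.sublist_append_iff.1 h'
    subst hl'
    rcases l₁ with _ | ⟨c, l₁⟩
    · rcases List.eq_nil_or_concat l₃ with rfl | ⟨l₃, c, rfl⟩
      · rw [List.nil_append, List.append_nil] at hl
        exact h₂.subset (by rw [← hl]; simp)
      · have hc : a = c := by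
          have := congrArg List.getLast? hl
          simpa using this
        subst hc
        exact absurd (h₃.subset (by simp)) (ht a ha)
    · simp only [List.cons_append, List.cons.injEq] at hl
      obtain ⟨rfl, -⟩ := hl
      exact absurd (h₁.subset (by simp)) (hs a ha)
  have hcross : ∀ a b, Crosses (crown k) a b → (a ∈ f ↔ b ∈ f) := fun a b h =>
    ⟨hmem a b (List.Sublist.trans (by simp) h), hmem b a (List.Sublist.trans (by simp) h)⟩
  have hlt : ∀ a ∈ f, a < k := fun a ha => mem_crown.1 (by rw [← hst]; simp [ha])
  have hzero : ∀ a, a < k - 1 → (0 ∈ f ↔ a ∈ f) := by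
    intro a
    induction a with
    | zero => simp
    | succ a ih =>
      intro h
      rw [ih (by omega)]
      exact hcross _ _ ((crosses_crown_iff hk).2 (Or.inl ⟨rfl, h⟩))
  have hlast : 0 ∈ f ↔ k - 1 ∈ f :=
    hcross _ _ ((crosses_crown_iff hk).2 (Or.inr (Or.inl ⟨rfl, rfl⟩)))
  have hiff : ∀ a, a < k → (0 ∈ f ↔ a ∈ f) := by
    intro a ha
    rcases Nat.lt_or_ge a (k - 1) with h | h
    · exact hzero a h
    · obtain rfl : a = k - 1 := by omega
      exact hlast
  obtain ⟨c, hc⟩ := List.exists_mem_of_ne_nil f hne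
  have hall : ∀ a ∈ crown k, a ∈ f := fun a ha =>
    (hiff a (mem_crown.1 ha)).1 ((hiff c (hlt c hc)).2 hc)
  have hs' : s = [] := List.eq_nil_iff_forall_not_mem.2 fun a ha =>
    hs a (hall a (by rw [← hst]; simp [ha])) ha
  have ht' : t = [] := List.eq_nil_iff_forall_not_mem.2 fun a ha =>
    ht a (hall a (by rw [← hst]; simp [ha])) ha
  rw [← hst, hs', ht']
  simp

/-- If a substitution turns a word, all of whose letters occur at least twice, into a crown, then
the letters of the crown embed into those of the word, and alternation is preserved. -/
theorem exists_embedding_of_flatMap_eq_crown {X : Type v} {k : ℕ} (hk : 5 ≤ k) {u : List X}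
    (hu : ∀ x ∈ u, [x, x].Sublist u) {θ : X → List ℕ} (h : u.flatMap θ = crown k) :
    ∃ φ : ℕ → X, (∀ a < k, φ a ∈ u) ∧
      (∀ a b, Crosses (crown k) a b → φ a ≠ φ b ∧ Crosses u (φ a) (φ b)) ∧
      φ 1 ≠ φ (k - 1) ∧ φ (k - 3) ≠ φ (k - 1) := by
  have hex : ∀ a : ℕ, ∃ x, a < k → x ∈ u ∧ a ∈ θ x := by
    have hne : ∀ a, a < k → ∃ x, x ∈ u ∧ a ∈ θ x := fun a ha => by
      have := mem_crown.2 ha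
      rw [← h, List.mem_flatMap] at this
      exact this
    obtain ⟨x₀, -⟩ := hne 0 (by omega)
    intro a
    by_cases ha : a < k
    · obtain ⟨x, hx⟩ := hne a ha
      exact ⟨x, fun _ => hx⟩
    · exact ⟨x₀, fun h => absurd h ha⟩
  choose φ hφ using hex
  have hquad : ∀ {x y z t : X} {a b c d : ℕ}, [x, y, z, t].Sublist u → a ∈ θ x → b ∈ θ y →
      c ∈ θ z → d ∈ θ t → [a, b, c, d].Sublist (crown k) := by
    intro x y z t a b c d h' ha hb hc hd
    rw [← h]
    exact List.quadruple_sublist_flatMap h' ha hb hc hd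
  have hlt : ∀ {a b}, Crosses (crown k) a b → a < k ∧ b < k := fun hab =>
    ⟨mem_crown.1 (hab.subset (by simp)), mem_crown.1 (hab.subset (by simp))⟩
  -- letters with distinct images
  have hforward : ∀ a b, a < k → b < k → Crosses u (φ a) (φ b) → Crosses (crown k) a b :=
    fun a b ha hb hc => hquad hc (hφ a ha).2 (hφ b hb).2 (hφ a ha).2 (hφ b hb).2
  have hback : ∀ a b, a ≠ b → Crosses (crown k) a b → φ a ≠ φ b → Crosses u (φ a) (φ b) := by
    intro a b hab hc hne
    obtain ⟨ha, hb⟩ := hlt hc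
    obtain ⟨hau, haθ⟩ := hφ a ha
    obtain ⟨hbu, hbθ⟩ := hφ b hb
    obtain ⟨n₁, n₂, n₃, n₄, n₅⟩ := hc.not_sublist hab
    -- Whatever the order of `φ a` and `φ b` in `u`, the crown inherits it for `a` and `b`, and it
    -- admits only the alternating one.
    rcases sublist_cases hne (hu _ hau) (hu _ hbu) with h' | h' | h' | h' | h' | h'
    · exact h'
    · exact absurd (hforward b a hb ha h') n₁
    · exact absurd (hquad h' haθ haθ hbθ hbθ) n₂
    · exact absurd (hquad h' hbθ hbθ haθ haθ) n₃
    · exact absurd (hquad h' haθ hbθ hbθ haθ) n₄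
    · exact absurd (hquad h' hbθ haθ haθ hbθ) n₅
  -- letters with the same image
  have hsame : ∀ a b, a ≠ b → a < k → b < k → φ a = φ b →
      Crosses (crown k) a b ∨ Crosses (crown k) b a := by
    intro a b hab ha hb he
    obtain ⟨hau, haθ⟩ := hφ a ha
    obtain ⟨-, hbθ⟩ := hφ b hb
    rw [← he] at hbθ
    have key : ∀ {c d : ℕ}, [c, d].Sublist (θ (φ a)) → Crosses (crown k) c d := by
      intro c d hcd
      rw [Crosses, ← h]
      refine List.Sublist.trans ?_ ((hu _ hau).flatMap θ)
      simpa using hcd.append hcd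
    obtain ⟨s, t, hst⟩ := List.append_of_mem haθ
    rw [hst] at hbθ
    rcases List.mem_append.1 hbθ with h' | h'
    · refine Or.inr (key ?_)
      rw [hst]
      exact (List.singleton_sublist.2 h').append (by simp : [a].Sublist (a :: t))
    · have h'' : b ∈ t := (List.mem_cons.1 h').resolve_left (Ne.symm hab)
      refine Or.inl (key ?_)
      rw [hst]
      exact (List.nil_sublist s).append ((List.singleton_sublist.2 h'').cons_cons a)
  -- If `φ a = φ b`, a letter `c` alternating with `b` but not with `a` has another image, so its
  -- alternation passes to `u` and back to `a` and `c`.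
  have hsep : ∀ a b c, a ≠ c → b ≠ c → a < k → Crosses (crown k) b c ∨ Crosses (crown k) c b →
      ¬ (Crosses (crown k) a c ∨ Crosses (crown k) c a) → φ a ≠ φ b := by
    intro a b c hac hbc ha hbc' hac' he
    have hc : c < k := by
      rcases hbc' with h' | h'
      · exact (hlt h').2
      · exact (hlt h').1
    have hac'' : φ a ≠ φ c := fun h' => hac' (hsame a c hac ha hc h')
    rcases hbc' with h' | h'
    · have := hback b c hbc h' (he ▸ hac'')
      rw [← he] at this
      exact hac' (Or.inl (hforward a c ha hc this))
    · have := hback c b hbc.symm h' (Ne.symm (he ▸ hac''))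
      rw [← he] at this
      exact hac' (Or.inr (hforward c a hc ha this))
  -- The cycle has no triangles, so neighbours `a`, `b` are separated by a further neighbour of one
  -- of them.
  have hne : ∀ a b, Crosses (crown k) a b → φ a ≠ φ b := by
    intro a b hab
    rw [crosses_crown_iff hk] at hab
    rcases hab with ⟨rfl, hb⟩ | ⟨rfl, rfl⟩ | ⟨rfl, rfl⟩
    · rcases Nat.eq_zero_or_pos a with rfl | ha
      · refine hsep 0 1 2 ?_ ?_ ?_ ?_ ?_ <;>
          (try simp only [crosses_crown_iff hk, true_and]) <;> omega
      · refine (hsep (a + 1) a (a - 1) ?_ ?_ ?_ ?_ ?_).symm <;>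
          (try simp only [crosses_crown_iff hk]) <;> omega
    · refine hsep 0 (k - 1) (k - 2) ?_ ?_ ?_ ?_ ?_ <;>
        (try simp only [crosses_crown_iff hk, true_and, and_true, true_or, or_true]) <;> omega
    · refine (hsep (k - 2) (k - 1) 0 ?_ ?_ ?_ ?_ ?_).symm <;>
        (try simp only [crosses_crown_iff hk, true_and, and_true, true_or, or_true]) <;> omega
  refine ⟨φ, fun a ha => (hφ a ha).1, fun a b hab => ⟨hne a b hab, ?_⟩, ?_, ?_⟩
  · exact hback a b (fun h' => hne a b hab (congrArg φ h')) hab (hne a b hab)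
  · intro he
    have := hsame 1 (k - 1) (by omega) (by omega) (by omega) he
    simp only [crosses_crown_iff hk] at this
    omega
  · intro he
    have := hsame (k - 3) (k - 1) (by omega) (by omega) (by omega) he
    simp only [crosses_crown_iff hk] at this
    omega

/-- The map `φ` preserves oriented edges. Only `0` has two outgoing edges and only `i - 2` two
incoming ones, so `φ 0 = 0` and `φ (j - 2) = i - 2`. As `i ≥ 5`, the short path goes to the short
path, and the long one is followed letter by letter until `j - 2 = i - 2`. -/
theorem eq_of_flatMap_crown_eq_crown {i j : ℕ} (hi : 5 ≤ i) (hj : 5 ≤ j) {θ : ℕ → List ℕ}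
    (h : (crown i).flatMap θ = crown j) : i = j := by
  obtain ⟨φ, -, hφ, h₁, h₂⟩ := exists_embedding_of_flatMap_eq_crown hj
    (fun x hx => pair_sublist_crown (by omega) (mem_crown.1 hx)) h
  have hE : ∀ a b, (b = a + 1 ∧ b < j - 1) ∨ (a = 0 ∧ b = j - 1) ∨ (a = j - 1 ∧ b = j - 2) →
      (φ b = φ a + 1 ∧ φ b < i - 1) ∨ (φ a = 0 ∧ φ b = i - 1) ∨ (φ a = i - 1 ∧ φ b = i - 2) :=
    fun a b hab => (crosses_crown_iff hi).1 (hφ a b ((crosses_crown_iff hj).2 hab)).2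
  have e₁ := hE 0 1 (by omega)
  have e₂ := hE 0 (j - 1) (by omega)
  have e₃ := hE (j - 3) (j - 2) (by omega)
  have e₄ := hE (j - 1) (j - 2) (by omega)
  have hpath : ∀ a, 1 ≤ a → a < j - 1 → φ a = a ∧ a < i - 1 := by
    intro a ha
    induction a, ha using Nat.le_induction with
    | base => intro _; omega
    | succ a ha ih =>
      intro h
      have := ih (by omega)
      have := hE a (a + 1) (by omega)
      omega
  have := hpath (j - 2) (by omega) (by omega)
  omega

/-- The two edges leaving `0` would have distinct images leaving `φ 0`, but no letter of `crownSwap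
i` has two outgoing edges. -/
theorem flatMap_crownSwap_ne_crown {i j : ℕ} (hi : 5 ≤ i) (hj : 5 ≤ j) {θ : ℕ → List ℕ} :
    (crownSwap i).flatMap θ ≠ crown j := by
  intro h
  obtain ⟨φ, -, hφ, h₁, h₂⟩ := exists_embedding_of_flatMap_eq_crown hj
    (fun x hx => pair_sublist_crownSwap (by omega) (mem_crownSwap.1 hx)) h
  have e₁ := (hφ 0 1 ((crosses_crown_iff hj).2 (by omega))).2.of_crownSwap hi
  have e₂ := (hφ 0 (j - 1) ((crosses_crown_iff hj).2 (by omega))).2.of_crownSwap hi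
  omega

theorem FreeMonoid.toList_map_eq_flatMap {X Y : Type*} (θ : FreeMonoid X →* FreeMonoid Y)
    (p : FreeMonoid X) :
    (θ p).toList = p.toList.flatMap fun x => (θ (FreeMonoid.of x)).toList := by
  induction p using FreeMonoid.inductionOn' with
  | one => simp
  | of_mul x p ih => simp [ih]

/-- The Rees quotient of `crown j` satisfies exactly those of the identities `crown i ≈ crownSwap i`
for which `i ≠ j`. -/
theorem satisfiesIdentity_crown_iff {i j : ℕ} (hi : 5 ≤ i) (hj : 5 ≤ j) :
    SatisfiesIdentity (FactorMonoid (crown j)) (FreeMonoid.ofList (crown i))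
      (FreeMonoid.ofList (crownSwap i)) ↔ i ≠ j := by
  constructor
  · rintro h rfl
    exact not_satisfiesIdentity_factorMonoid (w := FreeMonoid.ofList (crown i)) (by simp)
      (fun h => crown_ne_crownSwap (by omega) (FreeMonoid.ofList.injective h)) h
  · intro hij
    refine satisfiesIdentity_factorMonoid fun θ hθ => FreeMonoid.toList.injective ?_
    rw [FreeMonoid.toList_map_eq_flatMap, FreeMonoid.toList_map_eq_flatMap] at hθ ⊢
    simp only [FreeMonoid.toList_ofList] at hθ ⊢
    set ϑ := fun x => (θ (FreeMonoid.of x)).toList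
    have htwice : ∀ u : List ℕ, (∀ x ∈ u, [x, x].Sublist u) →
        ∀ a ∈ u.flatMap ϑ, [a, a].Sublist (u.flatMap ϑ) := by
      intro u hu a ha
      obtain ⟨x, hx, hax⟩ := List.mem_flatMap.1 ha
      exact List.pair_sublist_flatMap (hu x hx) hax hax
    have hnil : (crown i).flatMap ϑ = [] ↔ (crownSwap i).flatMap ϑ = [] := by
      simp [List.flatMap_eq_nil_iff, mem_crown, mem_crownSwap]
    -- A nonempty value that is a factor of `crown j` has each letter twice, so it is all of `crown
    -- j`, which is impossible for `i ≠ j`.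
    rcases hθ with hθ | hθ
    · by_cases hne : (crown i).flatMap ϑ = []
      · rw [hne, hnil.1 hne]
      · exact absurd (eq_of_flatMap_crown_eq_crown hi hj (eq_crown_of_isInfix hj hθ hne
          (htwice _ fun x hx => pair_sublist_crown (by omega) (mem_crown.1 hx)))) hij
    · by_cases hne : (crownSwap i).flatMap ϑ = []
      · rw [hne, hnil.2 hne]
      · exact absurd (eq_crown_of_isInfix hj hθ hne (htwice _ fun x hx =>
          pair_sublist_crownSwap (by omega) (mem_crownSwap.1 hx)))
          (flatMap_crownSwap_ne_crown hi hj)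

/-- For `n ≥ 3`, the word `xyx` (in distinct variables `x`, `y` of any alphabet) is an isoterm for
the stylic monoid of rank `n`, and the monoid variety generated by the stylic monoid of rank `n`
(lifted to the universe in which the classes of monoids are formed) has uncountably many
subvarieties. -/
theorem mainTheorem6 (n : ℕ) (hn : 3 ≤ n) :
    (∀ (X : Type v) (x y : X), x ≠ y →
      IsIsoterm (StylicMonoid n)
        (FreeMonoid.of x * FreeMonoid.of y * FreeMonoid.of x)) ∧
    ¬ (subvarieties (generatedVariety (ULift.{u} (StylicMonoid n)))).Countable := by
  refine ⟨fun X x y hxy => isIsoterm_xyx hn hxy, ?_⟩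
  refine not_countable_subvarieties (generatedVariety_isLeast _).1.1
    (fun i => FreeMonoid.ofList (crown (i + 5))) (fun i => FreeMonoid.ofList (crownSwap (i + 5)))
    fun j => ⟨_, factorMonoid_mem_generatedVariety (w := crown (j + 5)) ?_, fun i => ?_⟩
  · intro p q hp h
    exact SatisfiesIdentity.eq_of_count_le_two hn
      (fun a => (hp.sublist.count_le a).trans (count_crown_le _ a))
      (satisfiesIdentity_ulift_iff.1 h)
  · refine satisfiesIdentity_ulift_iff.trans ?_
    rw [satisfiesIdentity_crown_iff (by omega) (by omega)]
    omega
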